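/- Let $X$ be a compact metric space without isolated points, and let $C(X,X)$ be the space of continuous maps $X\to X$ with the topology of uniform convergence. A property holds for a generic $f\in C(X,X)$ if the set of all $f$ having it contains a dense $G_\delta$-subset of $C(X,X)$. For $f\in C(X,X)$ let $CR(f)$ be the set of chain recurrent points of $f$: the points $x$ such that for every $\varepsilon>0$ there are $n\ge 1$ and points $x=x_0,x_1,\dots,x_n=x$ with $d(f(x_{i-1}),x_i)<\varepsilon$ for $i=1,\dots,n$. For $l\ge 1$ let $Per_l(f)$ be the set of periodic points of $f$ whose orbit has at least $l$ elements. Assume that $X$ is an ANR (that is, whenever $X$ is embedded as a closed subset of a metrizable space $Z$, it is a retract of some open neighbourhood in $Z$), or that, for some integer $n\ge 0$, $X$ has covering dimension $n$ and is $LC^{n-1}$ (that is, for all $0\le k\le n-1$, every neighbourhood $U$ of a point contains a neighbourhood $V$ of that point such that each continuous map of the sphere $S^k$ into $V$ extends to a continuous map of the ball $B^{k+1}$ into $U$). Then: 1. for a generic $f\in C(X,X)$ the set $CR(f)$ is perfect (closed and without isolated points); 2. if $X$ has the weak local periodic point property, i.e. there is a base $\mathcal B$ of open sets of $X$ such that every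 continuous $f:X\to X$ with $f(\overline B)\subset B$ for some $B\in\mathcal B$ has a periodic point in that $B$, then for every integer $l\ge 2$, for a generic $f\in C(X,X)$, the set $CR(f)$ is perfect and $\overline{Per_l(f)}=CR(f)$. -/

import Mathlib

open Set Filter Topology

universe u

namespace GenericCR

/-- A metrizable space `X` is an ANR if, whenever it is embedded as a closed subset of a metrizable
space `Z`, it is a retract of some open neighbourhood in `Z`. -/
def IsANR (X : Type u) [TopologicalSpace X] : Prop :=
  TopologicalSpace.MetrizableSpace X ∧
    ∀ (Z : Type u) [TopologicalSpace Z] [TopologicalSpace.MetrizableSpace Z] (e : X → Z),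
      IsClosedEmbedding e →
        ∃ U : Set Z, IsOpen U ∧ range e ⊆ U ∧
          ∃ r : C(U, X), ∀ (x : X) (hx : e x ∈ U), r ⟨e x, hx⟩ = x

/-- `X` is locally `k`-connected: every neighbourhood `U` of a point contains a neighbourhood `V`
of that point such that each map of the `k`-sphere into `V` extends to a map of the
`(k+1)`-ball into `U`. -/
def LocallyKConnected (X : Type*) [TopologicalSpace X] (k : ℕ) : Prop :=
  ∀ x : X, ∀ U ∈ 𝓝 x, ∃ V ∈ 𝓝 x, V ⊆ U ∧
    ∀ φ : C(Metric.sphere (0 : EuclideanSpace ℝ (Fin (k + 1))) 1, X), (∀ s, φ s ∈ V) →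
      ∃ ψ : C(Metric.closedBall (0 : EuclideanSpace ℝ (Fin (k + 1))) 1, X),
        (∀ b, ψ b ∈ U) ∧ ∀ s, ψ ⟨s.1, Metric.sphere_subset_closedBall s.2⟩ = φ s

/-- `X` is an `LC^m` space: locally `k`-connected for all `0 ≤ k ≤ m` (no condition if `m = -1`). -/
def IsLC (X : Type*) [TopologicalSpace X] (m : ℤ) : Prop :=
  ∀ k : ℕ, (k : ℤ) ≤ m → LocallyKConnected X k

/-- Every finite open cover of `X` has a finite open refinement such that each point lies in at
most `m` of its members; that is, the covering dimension of `X` is at most `m - 1`. -/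
def CoverMultiplicityLE (X : Type*) [TopologicalSpace X] (m : ℕ) : Prop :=
  ∀ 𝒰 : Set (Set X), 𝒰.Finite → (∀ U ∈ 𝒰, IsOpen U) → ⋃₀ 𝒰 = univ →
    ∃ 𝒱 : Set (Set X), 𝒱.Finite ∧ (∀ V ∈ 𝒱, IsOpen V) ∧ ⋃₀ 𝒱 = univ ∧
      (∀ V ∈ 𝒱, ∃ U ∈ 𝒰, V ⊆ U) ∧ ∀ x : X, {V ∈ 𝒱 | x ∈ V}.encard ≤ m

/-- The covering dimension of `X` is exactly `n`. -/
def IsNDimensional (X : Type*) [TopologicalSpace X] (n : ℕ) : Prop :=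
  CoverMultiplicityLE X (n + 1) ∧ ¬ CoverMultiplicityLE X n

/-- There is an `ε`-chain `x = c 0, c 1, …, c n = y` for `f`, with `n ≥ 1`. -/
def HasChain {X : Type*} [MetricSpace X] (f : X → X) (ε : ℝ) (x y : X) : Prop :=
  ∃ (n : ℕ) (c : ℕ → X), 1 ≤ n ∧ c 0 = x ∧ c n = y ∧ ∀ i < n, dist (f (c i)) (c (i + 1)) < ε

/-- The set of chain recurrent points of `f`. -/
def chainRecurrent {X : Type*} [MetricSpace X] (f : X → X) : Set X :=
  {x | ∀ ε : ℝ, 0 < ε → HasChain f ε x x}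

/-- The periodic points of `f` whose orbit has at least `l` elements. -/
def perGE {X : Type*} (f : X → X) (l : ℕ) : Set X :=
  {x | x ∈ Function.periodicPts f ∧ (l : ℕ∞) ≤ (range fun i : ℕ => f^[i] x).encard}

/-- The weak local periodic point property. -/
def WLPPP (X : Type*) [TopologicalSpace X] : Prop :=
  ∃ 𝓑 : Set (Set X), TopologicalSpace.IsTopologicalBasis 𝓑 ∧
    ∀ B ∈ 𝓑, ∀ f : C(X, X), f '' closure B ⊆ B → ∃ x ∈ B, x ∈ Function.periodicPts f

end GenericCR

/-! A closed pseudo-orbit can be turned into a superattracting cycle by a small perturbation. Given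
`x` in `CR(f)`, take a fine chain from `x` to `x`, run through it several times, and move its points
slightly so that they become distinct, which is possible since `X` has no isolated points. A
perturbation `g` of `f` then follows the chain exactly and is constant near each of its points
(`PerturbationProperty.exists_cycle`). Every map close to `g` carries small balls along this cycle,
so its `N`-th iterate maps each of them into itself. This forces chain recurrent points near two
distinct cycle points close to `x` and, under the weak local periodic point property, a periodic
point close to `x` whose orbit has at least `N` elements. Both conclusions persist under small
changes of the map, and `CR` is upper semicontinuous, so a Baire argument over a countable base
makes them generic (`eventually_residual_forall_mem_chainRecurrent`).

The hypotheses on `X` serve only to prescribe finitely many values (`PerturbationProperty`). For an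
ANR, interpolate in the linear space `C(X, ℝ)` and retract. In the finite-dimensional `LC` case,
factor an approximation of `f` through the nerve of a fine cover and extend over simplices
(`exists_map_skeleton`). -/

namespace GenericCR

/-! ### Chains, semicontinuity of `CR` and the Baire argument. -/

section Chains

variable {X : Type*} [MetricSpace X]

/-- An `α`-chain for `f'` becomes an `ε`-chain for a nearby `f` with nearby endpoints. -/
theorem HasChain.perturb {f f' : X → X} {α β γ δ ε : ℝ} {x x' y y' : X}
    (h : HasChain f' α x' y') (hβ : dist (f x) (f x') ≤ β) (hγ : ∀ z, dist (f z) (f' z) ≤ γ)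
    (hδ : dist y' y ≤ δ) (hε : β + γ + α + δ ≤ ε) : HasChain f ε x y := by
  obtain ⟨n, c, hn, h0, hcn, hc⟩ := h
  have hβ0 : 0 ≤ β := dist_nonneg.trans hβ
  have hδ0 : 0 ≤ δ := dist_nonneg.trans hδ
  -- Only the two ends of the chain move: `β` enters at the first jump and `δ` at the last. These
  -- are the same jump when `n = 1`, hence the sum in `hε`.
  refine ⟨n, fun i => if i = 0 then x else if i = n then y else c i, hn, by simp, ?_, ?_⟩
  · simp [show n ≠ 0 by omega]
  · intro i hi
    have h1 : dist (f (if i = 0 then x else if i = n then y else c i)) (f (c i)) ≤ β := by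
      by_cases h : i = 0
      · subst h; simpa [h0] using hβ
      · simpa [h, hi.ne] using hβ0
    have h2 : dist (c (i + 1)) (if i + 1 = 0 then x else if i + 1 = n then y else c (i + 1)) ≤ δ := by
      by_cases h : i + 1 = n
      · simpa [h, hcn, show n ≠ 0 by omega] using hδ
      · simpa [h] using hδ0
    have h3 := hc i hi
    have h4 := hγ (c i)
    refine lt_of_le_of_lt (dist_triangle4 _ (f (c i)) (f' (c i)) _) ?_
    have := dist_triangle (f' (c i)) (c (i + 1))
      (if i + 1 = 0 then x else if i + 1 = n then y else c (i + 1))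
    linarith

theorem hasChain_iterate (f : X → X) {ε : ℝ} (hε : 0 < ε) {n : ℕ} (hn : 1 ≤ n) (x : X) :
    HasChain f ε x (f^[n] x) :=
  ⟨n, fun i => f^[i] x, hn, rfl, rfl, fun i _ => by
    simpa [Function.iterate_succ_apply'] using hε⟩

theorem periodicPts_subset_chainRecurrent (f : X → X) :
    Function.periodicPts f ⊆ chainRecurrent f := by
  rintro x ⟨n, hn, hx⟩ ε hε
  have := hasChain_iterate f hε hn x
  rwa [hx] at this

variable [CompactSpace X]

/-- An `ε / 4`-chain for a nearby map at a nearby point is an `ε`-chain for the limit pair: by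
`HasChain.perturb` there are four errors, each at most `ε / 4`. This is the upper semicontinuity of
`CR`. -/
theorem isClosed_setOf_mem_chainRecurrent :
    IsClosed {p : C(X, X) × X | p.2 ∈ chainRecurrent p.1} := by
  rw [← isOpen_compl_iff, isOpen_iff_mem_nhds]
  rintro ⟨f, x⟩ hfx
  by_contra hcon
  apply hfx
  intro ε hε
  have h1 : ∀ᶠ p : C(X, X) × X in 𝓝 (f, x), dist p.1 f < ε / 4 :=
    Metric.tendsto_nhds.1 (continuous_fst.tendsto (f, x)) _ (by positivity)
  have h2 : ∀ᶠ p : C(X, X) × X in 𝓝 (f, x), dist p.2 x < ε / 4 :=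
    Metric.tendsto_nhds.1 (continuous_snd.tendsto (f, x)) _ (by positivity)
  have h3 : ∀ᶠ p : C(X, X) × X in 𝓝 (f, x), dist (f p.2) (f x) < ε / 4 :=
    Metric.tendsto_nhds.1 ((f.continuous.comp continuous_snd).tendsto (f, x)) _ (by positivity)
  obtain ⟨⟨g, y⟩, hgy, h1, h2, h3⟩ :=
    ((Filter.not_eventually.1 hcon).and_eventually (h1.and (h2.and h3))).exists
  have hgy : y ∈ chainRecurrent g := not_not.1 hgy
  exact (hgy (ε / 4) (by positivity)).perturb (β := ε / 4) (γ := ε / 4) (by rw [dist_comm]; exact h3.le)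
    (fun z => by
      rw [dist_comm]; exact (ContinuousMap.dist_apply_le_dist z).trans h1.le) h2.le (by linarith)

theorem isClosed_chainRecurrent (f : C(X, X)) : IsClosed (chainRecurrent f) :=
  isClosed_setOf_mem_chainRecurrent.preimage (Continuous.prodMk_right f)

theorem isOpen_setOf_disjoint_chainRecurrent {K : Set X} (hK : IsClosed K) :
    IsOpen {f : C(X, X) | Disjoint (chainRecurrent f) K} := by
  have h := isClosedMap_fst_of_compactSpace _
    ((isClosed_setOf_mem_chainRecurrent (X := X)).inter (hK.preimage continuous_snd))
  convert h.isOpen_compl using 1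
  ext f
  simp only [mem_ofPred_eq, mem_compl_iff, mem_image, not_exists, Set.disjoint_left]
  constructor
  · rintro h ⟨g, x⟩ ⟨⟨h1, h2⟩, rfl⟩
    exact h h1 h2
  · intro h x h1 h2
    exact h (f, x) ⟨⟨h1, h2⟩, rfl⟩

/-- A nonempty closed set mapped into itself by an iterate of `f` meets `CR(f)`. -/
theorem exists_mem_chainRecurrent_of_mapsTo (f : C(X, X)) {K : Set X} (hK : IsClosed K)
    (hne : K.Nonempty) {n : ℕ} (hn : 1 ≤ n) (hmaps : MapsTo f^[n] K K) :
    ∃ x ∈ K, x ∈ chainRecurrent f := by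
  obtain ⟨y, hy⟩ := hne
  obtain ⟨z, hz, φ, hφ, hlim⟩ := hK.isCompact.tendsto_subseq
    (x := fun j => (f^[n])^[j] y) (fun j => hmaps.iterate j hy)
  refine ⟨z, hz, fun ε hε => ?_⟩
  have h1 := (Metric.tendsto_nhds.1 hlim) (ε / 3) (by positivity)
  have h2 := (Metric.tendsto_nhds.1 ((f.continuous.tendsto z).comp hlim)) (ε / 3) (by positivity)
  obtain ⟨N, hN⟩ := (h1.and h2).exists_forall_of_atTop
  have hlt : φ N < φ (N + 1) := hφ (Nat.lt_succ_self N)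
  -- The true orbit between two visits close to `z` becomes a chain from `z` to `z` once its ends
  -- are moved to `z`.
  have key := hasChain_iterate f (show 0 < ε / 3 by positivity)
    (show 1 ≤ n * (φ (N + 1) - φ N) from Nat.mul_pos hn (by omega)) ((f^[n])^[φ N] y)
  have heq : f^[n * (φ (N + 1) - φ N)] ((f^[n])^[φ N] y) = (f^[n])^[φ (N + 1)] y := by
    rw [Function.iterate_mul, ← Function.iterate_add_apply]
    congr 1
    omega
  rw [heq] at key
  refine key.perturb (β := ε / 3) (γ := 0) (δ := ε / 3) ?_ (by simp) ?_ (by linarith)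
  · rw [dist_comm]; exact (hN N le_rfl).2.le
  · exact (hN (N + 1) (by omega)).1.le

theorem closure_perGE_subset_chainRecurrent (f : C(X, X)) (l : ℕ) :
    closure (perGE f l) ⊆ chainRecurrent f :=
  closure_minimal (fun _ hx => periodicPts_subset_chainRecurrent f hx.1)
    (isClosed_chainRecurrent f)

/-- A property of the germ of a map at its chain recurrent points that can be made robust by
arbitrarily small perturbations holds generically. -/
theorem eventually_residual_forall_mem_chainRecurrent (Q : C(X, X) → Set X → Prop)
    (hmono : ∀ f s t, s ⊆ t → Q f s → Q f t)
    (hQ : ∀ f : C(X, X), ∀ x ∈ chainRecurrent f, ∀ V, IsOpen V → x ∈ V → ∀ ε : ℝ, 0 < ε →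
      ∃ g : C(X, X), dist g f < ε ∧ ∀ᶠ h in 𝓝 g, Q h V) :
    ∀ᶠ f : C(X, X) in residual C(X, X), ∀ x ∈ chainRecurrent f, ∀ V ∈ 𝓝 x, Q f V := by
  obtain ⟨b, hbc, -, hb⟩ := TopologicalSpace.exists_countable_basis X
  have key : ∀ U ∈ b, ∀ V ∈ b, closure U ⊆ V → ∀ᶠ f : C(X, X) in residual C(X, X),
      Disjoint (chainRecurrent f) (closure U) ∨ Q f V := by
    intro U _ V hV hUV
    -- The first alternative is already open. Where it fails, `hQ` perturbs `f` into the interior of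
    -- the second, so the union is dense.
    have ho : IsOpen ({f : C(X, X) | Disjoint (chainRecurrent f) (closure U)} ∪
        interior {f | Q f V}) :=
      (isOpen_setOf_disjoint_chainRecurrent isClosed_closure).union isOpen_interior
    refine mem_of_superset (residual_of_dense_open ho ?_) ?_
    · rw [Metric.dense_iff]
      intro f ε hε
      by_cases hf : Disjoint (chainRecurrent f) (closure U)
      · exact ⟨f, Metric.mem_ball_self hε, Or.inl hf⟩
      · obtain ⟨x, hx, hxU⟩ := not_disjoint_iff.1 hf
        obtain ⟨g, hg, hgQ⟩ := hQ f x hx V (hb.isOpen hV) (hUV hxU) ε hε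
        exact ⟨g, hg, Or.inr (mem_interior_iff_mem_nhds.2 hgQ)⟩
    · rintro f (hf | hf)
      · exact Or.inl hf
      · exact Or.inr (interior_subset (s := {f | Q f V}) hf)
  have key' : ∀ᶠ f : C(X, X) in residual C(X, X), ∀ U ∈ b, ∀ V ∈ b, closure U ⊆ V →
      Disjoint (chainRecurrent f) (closure U) ∨ Q f V := by
    refine (eventually_countable_ball hbc).2 fun U hU => (eventually_countable_ball hbc).2
      fun V hV => ?_
    by_cases h : closure U ⊆ V
    · filter_upwards [key U hU V hV h] with f hf _ using hf
    · exact Eventually.of_forall fun f h' => absurd h' h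
  filter_upwards [key'] with f hf x hx W hW
  obtain ⟨V, hV, hxV, hVW⟩ := hb.mem_nhds_iff.1 hW
  obtain ⟨U, hU, hxU, hUV⟩ := hb.exists_closure_subset ((hb.isOpen hV).mem_nhds hxV)
  rcases hf U hU V hV hUV with h | h
  · exact absurd (subset_closure hxU) (disjoint_left.1 h hx)
  · exact hmono f V W hVW h

end Chains

/-! ### Simplices as Euclidean balls. -/

section Simplex

/-- The corner simplex is closed, convex and bounded with nonempty interior, so a homeomorphism of
the whole space takes it to the unit ball and its frontier to the sphere. The interior is found by
moving a point in coordinate directions. -/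
theorem exists_homeomorph_cornerSimplex (k : ℕ) :
    ∃ h : EuclideanSpace ℝ (Fin k) ≃ₜ EuclideanSpace ℝ (Fin k),
      ∀ x, (h x ∈ Metric.closedBall 0 1 ↔ (∀ j, 0 ≤ x j) ∧ ∑ j, x j ≤ 1) ∧
        (h x ∈ Metric.sphere 0 1 ↔
          ((∀ j, 0 ≤ x j) ∧ ∑ j, x j ≤ 1) ∧ ((∃ j, x j = 0) ∨ ∑ j, x j = 1)) := by
  set s : Set (EuclideanSpace ℝ (Fin k)) := {x | (∀ j, 0 ≤ x j) ∧ ∑ j, x j ≤ 1} with hs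
  set o : Set (EuclideanSpace ℝ (Fin k)) := {x | (∀ j, 0 < x j) ∧ ∑ j, x j < 1} with ho
  have hcl : IsClosed s := by
    have h1 : IsClosed {x : EuclideanSpace ℝ (Fin k) | ∀ j, 0 ≤ x j} := by
      simp only [ofPred_forall]
      exact isClosed_iInter fun j => isClosed_le continuous_const (by fun_prop)
    exact h1.inter (isClosed_le (f := fun x : EuclideanSpace ℝ (Fin k) => ∑ j, x j) (by fun_prop)
      continuous_const)
  have hop : IsOpen o := by
    have h1 : IsOpen {x : EuclideanSpace ℝ (Fin k) | ∀ j, 0 < x j} := by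
      simp only [ofPred_forall]
      exact isOpen_iInter_of_finite fun j => isOpen_lt continuous_const (by fun_prop)
    exact h1.inter (isOpen_lt (f := fun x : EuclideanSpace ℝ (Fin k) => ∑ j, x j) (by fun_prop)
      continuous_const)
  have hos : o ⊆ s := fun x hx => ⟨fun j => (hx.1 j).le, hx.2.le⟩
  have hint : interior s = o := by
    refine subset_antisymm (fun x hx => ?_) (interior_maximal hos hop)
    have hxs : x ∈ s := interior_subset hx
    have hline : ∀ v : EuclideanSpace ℝ (Fin k), ∃ t : ℝ, 0 < t ∧ x + t • v ∈ s := by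
      intro v
      have hc : ContinuousAt (fun t : ℝ => x + t • v) 0 := by fun_prop
      have hev : ∀ᶠ t : ℝ in 𝓝 0, x + t • v ∈ s :=
        hc (by simpa using mem_interior_iff_mem_nhds.1 hx)
      have : ∀ᶠ t : ℝ in 𝓝[>] 0, x + t • v ∈ s := hev.filter_mono nhdsWithin_le_nhds
      obtain ⟨t, ht, ht'⟩ := (this.and self_mem_nhdsWithin).exists
      exact ⟨t, ht', ht⟩
    have hpos : ∀ j, 0 < x j := by
      intro j
      obtain ⟨t, ht, hts⟩ := hline (EuclideanSpace.single j (-1))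
      have := hts.1 j
      simp at this
      linarith
    refine ⟨hpos, ?_⟩
    rcases isEmpty_or_nonempty (Fin k) with hk | ⟨⟨j⟩⟩
    · simp
    · obtain ⟨t, ht, hts⟩ := hline (EuclideanSpace.single j 1)
      have := hts.2
      simp [Finset.sum_add_distrib] at this
      linarith
  have hconv : Convex ℝ s := by
    rintro x ⟨hx, hx'⟩ y ⟨hy, hy'⟩ a b ha hb hab
    refine ⟨fun j => ?_, ?_⟩
    · have := mul_nonneg ha (hx j)
      have := mul_nonneg hb (hy j)
      simp
      linarith
    · simp only [PiLp.add_apply, PiLp.smul_apply, smul_eq_mul, Finset.sum_add_distrib,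
        ← Finset.mul_sum]
      nlinarith
  have hbd : Bornology.IsBounded s := by
    refine (Metric.isBounded_closedBall (x := (0 : EuclideanSpace ℝ (Fin k)))
      (r := √k)).subset fun x hx => ?_
    rw [mem_closedBall_zero_iff, EuclideanSpace.norm_eq]
    apply Real.sqrt_le_sqrt
    calc ∑ i, ‖x i‖ ^ 2 ≤ ∑ i : Fin k, (1 : ℝ) := by
          refine Finset.sum_le_sum fun i _ => ?_
          have h1 : x i ≤ 1 :=
            (Finset.single_le_sum (fun j _ => hx.1 j) (Finset.mem_univ i)).trans hx.2
          have h0 := hx.1 i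
          rw [Real.norm_eq_abs, sq_abs]
          nlinarith
      _ = k := by simp
  have hne : (interior s).Nonempty := by
    rw [hint]
    refine ⟨WithLp.toLp 2 fun _ => 1 / (k + 1 : ℝ), fun j => ?_, ?_⟩
    · simp; positivity
    · simp only [Finset.sum_const, Finset.card_univ, Fintype.card_fin, nsmul_eq_mul]
      rw [mul_one_div, div_lt_one (by positivity)]
      linarith
  obtain ⟨h, -, h2, h3⟩ := exists_homeomorph_image_interior_closure_frontier_eq_unitBall hconv hne hbd
  refine ⟨h, fun x => ⟨?_, ?_⟩⟩
  · rw [← h2, h.injective.mem_set_image, hcl.closure_eq]; rfl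
  · rw [← h3, h.injective.mem_set_image, hcl.frontier_eq, hint]
    constructor
    · rintro ⟨hxs, hxo⟩
      refine ⟨hxs, ?_⟩
      by_contra hcon
      push Not at hcon
      exact hxo ⟨fun j => (hxs.1 j).lt_of_ne' (hcon.1 j), hxs.2.lt_of_ne hcon.2⟩
    · rintro ⟨hxs, hx⟩
      refine ⟨hxs, fun hxo => ?_⟩
      rcases hx with ⟨j, hj⟩ | hx
      · exact (hxo.1 j).ne' hj
      · exact hxo.2.ne hx

variable {ι : Type*} [Fintype ι]

/-- The face of the standard simplex with vertex set `σ`. -/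
def face (σ : Finset ι) : Set (ι → ℝ) :=
  {t | (∀ i, 0 ≤ t i) ∧ ∑ i, t i = 1 ∧ ∀ i ∉ σ, t i = 0}

/-- The relative boundary of a face of the standard simplex. -/
def faceBoundary (σ : Finset ι) : Set (ι → ℝ) :=
  {t | t ∈ face σ ∧ ∃ i ∈ σ, t i = 0}

theorem isClosed_face (σ : Finset ι) : IsClosed (face σ) := by
  have h1 : IsClosed {t : ι → ℝ | ∀ i, 0 ≤ t i} := by
    simp only [ofPred_forall]
    exact isClosed_iInter fun j => isClosed_le continuous_const (by fun_prop)
  have h2 : IsClosed {t : ι → ℝ | ∑ i, t i = 1} := isClosed_eq (by fun_prop) continuous_const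
  have h3 : IsClosed {t : ι → ℝ | ∀ i ∉ σ, t i = 0} := by
    simp only [ofPred_forall]
    exact isClosed_iInter fun j => isClosed_iInter fun _ =>
      isClosed_eq (by fun_prop) continuous_const
  exact h1.inter (h2.inter h3)

/-- Coordinates identifying a `(k+1)`-dimensional face, and its boundary, with the
Euclidean ball and sphere. -/
theorem exists_face_chart {k : ℕ} (σ : Finset ι) (hσ : σ.card = k + 2) :
    ∃ (a : (ι → ℝ) → EuclideanSpace ℝ (Fin (k + 1))) (b : EuclideanSpace ℝ (Fin (k + 1)) → ι → ℝ),
      Continuous a ∧ Continuous b ∧ (∀ t ∈ face σ, b (a t) = t) ∧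
      (∀ t ∈ face σ, a t ∈ Metric.closedBall 0 1) ∧
      (∀ t ∈ faceBoundary σ, a t ∈ Metric.sphere 0 1) ∧
      (∀ x ∈ Metric.sphere 0 1, b x ∈ faceBoundary σ) := by
  classical
  obtain ⟨h, hh⟩ := exists_homeomorph_cornerSimplex (k + 1)
  let e : Fin (k + 2) ≃ σ := (Finset.equivFinOfCardEq hσ).symm
  -- `A` drops the barycentric coordinate at the vertex `e 0`; `C` restores it as one minus the sum
  -- of the others.
  let A : (ι → ℝ) → EuclideanSpace ℝ (Fin (k + 1)) :=
    fun t => WithLp.toLp 2 fun j => t (e j.succ)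
  let C : EuclideanSpace ℝ (Fin (k + 1)) → Fin (k + 2) → ℝ :=
    fun x => Fin.cons (1 - ∑ j, x j) x
  let B : EuclideanSpace ℝ (Fin (k + 1)) → ι → ℝ :=
    fun x i => if hi : i ∈ σ then C x (e.symm ⟨i, hi⟩) else 0
  have hA : Continuous A := by fun_prop
  have hC : Continuous C := by
    refine continuous_pi fun j => ?_
    refine Fin.cases ?_ (fun j => ?_) j
    · simp only [C, Fin.cons_zero]; fun_prop
    · simp only [C, Fin.cons_succ]; fun_prop
  have hB : Continuous B := by
    refine continuous_pi fun i => ?_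
    by_cases hi : i ∈ σ
    · simp only [B, hi, dite_true]
      exact (continuous_apply _).comp hC
    · simp only [B, hi, dite_false]
      exact continuous_const
  have hBe : ∀ x j, B x (e j) = C x j := by
    intro x j
    simp [B]
  have hsum : ∀ t : ι → ℝ, (∀ i ∉ σ, t i = 0) → ∑ i, t i = t (e 0) + ∑ j : Fin (k + 1), t (e j.succ) := by
    intro t ht
    rw [← Fin.sum_univ_succ (fun j : Fin (k + 2) => t (e j)), e.sum_comp (fun i : σ => t i),
      Finset.sum_coe_sort σ t]
    exact (Finset.sum_subset (Finset.subset_univ σ) fun i _ hi => ht i hi).symm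
  have hBout : ∀ x, ∀ i ∉ σ, B x i = 0 := fun x i hi => by simp [B, hi]
  have hBA : ∀ t ∈ face σ, B (A t) = t := by
    intro t ht
    funext i
    by_cases hi : i ∈ σ
    · obtain ⟨j, hj⟩ := e.surjective ⟨i, hi⟩
      have hij : i = e j := by rw [hj]
      rw [hij, hBe]
      refine Fin.cases ?_ (fun j => ?_) j
      · have := hsum t ht.2.2
        rw [ht.2.1] at this
        simp only [C, A, Fin.cons_zero]
        linarith
      · simp [C, A]
    · rw [hBout _ i hi, ht.2.2 i hi]
  have hAface : ∀ t ∈ face σ, (∀ j, 0 ≤ A t j) ∧ ∑ j, A t j ≤ 1 := by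
    intro t ht
    refine ⟨fun j => ht.1 _, ?_⟩
    have := hsum t ht.2.2
    rw [ht.2.1] at this
    have h0 := ht.1 (e 0)
    simp only [A]
    linarith
  refine ⟨h ∘ A, B ∘ h.symm, h.continuous.comp hA, hB.comp h.symm.continuous, ?_, ?_, ?_, ?_⟩
  · intro t ht
    simpa using hBA t ht
  · intro t ht
    exact (hh _).1.2 (hAface t ht)
  · rintro t ⟨ht, i, hi, hti⟩
    refine (hh _).2.2 ⟨hAface t ht, ?_⟩
    obtain ⟨j, hj⟩ := e.surjective ⟨i, hi⟩
    have hij : i = e j := by rw [hj]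
    rw [hij] at hti
    revert hti
    refine Fin.cases (fun h0 => Or.inr ?_) (fun j hj => Or.inl ⟨j, hj⟩) j
    have := hsum t ht.2.2
    rw [ht.2.1, h0] at this
    simp only [A]
    linarith
  · intro y hy
    obtain ⟨x, rfl⟩ := h.surjective y
    obtain ⟨⟨h0, h1⟩, h2⟩ := (hh x).2.1 hy
    simp only [Function.comp_apply, h.symm_apply_apply]
    refine ⟨⟨fun i => ?_, ?_, hBout x⟩, ?_⟩
    · by_cases hi : i ∈ σ
      · obtain ⟨j, hj⟩ := e.surjective ⟨i, hi⟩
        have hij : i = e j := by rw [hj]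
        rw [hij, hBe]
        refine Fin.cases ?_ (fun j => ?_) j
        · simp only [C, Fin.cons_zero]; linarith
        · simpa [C] using h0 j
      · rw [hBout x i hi]
    · rw [hsum _ (hBout x)]
      simp [hBe, C]
    · rcases h2 with ⟨j, hj⟩ | h2
      · exact ⟨e j.succ, (e j.succ).2, by simp [hBe, C, hj]⟩
      · exact ⟨e 0, (e 0).2, by simp [hBe, C, h2]⟩

theorem exists_extension_face {X : Type*} [TopologicalSpace X] {k : ℕ} (σ : Finset ι)
    (hσ : σ.card = k + 2) {U V : Set X}
    (hUV : ∀ φ : C(Metric.sphere (0 : EuclideanSpace ℝ (Fin (k + 1))) 1, X), (∀ s, φ s ∈ V) →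
      ∃ ψ : C(Metric.closedBall (0 : EuclideanSpace ℝ (Fin (k + 1))) 1, X),
        (∀ b, ψ b ∈ U) ∧ ∀ s, ψ ⟨s.1, Metric.sphere_subset_closedBall s.2⟩ = φ s)
    (p : (ι → ℝ) → X) (hp : ContinuousOn p (faceBoundary σ)) (hpV : MapsTo p (faceBoundary σ) V) :
    ∃ q : (ι → ℝ) → X, ContinuousOn q (face σ) ∧ MapsTo q (face σ) U ∧
      ∀ t ∈ faceBoundary σ, q t = p t := by
  obtain ⟨a, b, ha, hb, hba, ha1, ha2, hb2⟩ := exists_face_chart σ hσ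
  obtain ⟨ψ, hψU, hψ⟩ := hUV ⟨fun s => p (b s), by
    exact hp.comp_continuous (hb.comp continuous_subtype_val) fun s => hb2 s s.2⟩
    (fun s => hpV (hb2 s s.2))
  classical
  refine ⟨fun t => if h : a t ∈ Metric.closedBall 0 1 then ψ ⟨a t, h⟩ else p t, ?_, ?_, ?_⟩
  · rw [continuousOn_iff_continuous_domRestrict]
    have : (face σ).domRestrict (fun t => if h : a t ∈ Metric.closedBall 0 1 then ψ ⟨a t, h⟩ else p t)
        = fun t : face σ => ψ ⟨a t, ha1 t t.2⟩ := by
      funext t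
      simp only [domRestrict_apply]
      rw [dif_pos (ha1 t t.2)]
    rw [this]
    exact ψ.continuous.comp ((ha.comp continuous_subtype_val).subtype_mk _)
  · intro t ht
    simp only
    rw [dif_pos (ha1 t ht)]
    exact hψU _
  · intro t ht
    simp only
    rw [dif_pos (ha1 t ht.1)]
    have := hψ ⟨a t, ha2 t ht⟩
    simp only [ContinuousMap.coe_mk] at this
    rw [this, hba t ht.1]

end Simplex

/-! ### Prescribing finitely many values by a small perturbation. -/

section Perturbation

/-- Every finite perturbation of the values of a map `f` by less than `δ` is realized by a map
uniformly `ε`-close to `f` and locally constant at the prescribed points. -/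
def PerturbationProperty (X : Type*) [MetricSpace X] [CompactSpace X] : Prop :=
  ∀ f : C(X, X), ∀ ε : ℝ, 0 < ε → ∃ δ : ℝ, 0 < δ ∧ ∀ (s : Finset X) (b : X → X),
    (∀ a ∈ s, dist (f a) (b a) < δ) →
      ∃ g : C(X, X), dist g f < ε ∧ ∀ a ∈ s, ∀ᶠ y in 𝓝 a, g y = b a

theorem exists_pos_lt_dist_of_finset {X : Type*} [MetricSpace X] (s : Finset X) :
    ∃ ρ : ℝ, 0 < ρ ∧ ∀ a ∈ s, ∀ b ∈ s, a ≠ b → ρ < dist a b := by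
  have : ∀ᶠ ρ : ℝ in 𝓝[>] 0, ∀ a ∈ s, ∀ b ∈ s, a ≠ b → ρ < dist a b := by
    refine (s.eventually_all).2 fun a _ => (s.eventually_all).2 fun b _ => ?_
    by_cases hab : a = b
    · exact Eventually.of_forall fun _ h => absurd hab h
    · filter_upwards [(eventually_lt_nhds (dist_pos.2 hab)).filter_mono nhdsWithin_le_nhds]
        with ρ hρ _ using hρ
  obtain ⟨ρ, h1, h2⟩ := (this.and self_mem_nhdsWithin).exists
  exact ⟨ρ, h2, h1⟩

/-- A compact metric space that is an ANR is a uniform neighbourhood retract of its image under the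
Kuratowski embedding. -/
theorem IsANR.exists_near_retraction {X : Type u} [MetricSpace X] [CompactSpace X] [Nonempty X]
    (hX : IsANR X) : ∃ e : X → C(X, ℝ), (∀ x y, dist (e x) (e y) ≤ dist x y) ∧
      ∃ r : C(X, ℝ) → X, ∀ ε : ℝ, 0 < ε → ∃ δ : ℝ, 0 < δ ∧
        (∀ x z, dist z (e x) < δ → ContinuousAt r z ∧ dist (r z) x < ε) ∧ ∀ x, r (e x) = x := by
  let e : X → C(X, ℝ) := fun x => ⟨fun y => dist x y, by fun_prop⟩
  have he : ∀ x y, dist (e x) (e y) ≤ dist x y := fun x y => by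
    rw [ContinuousMap.dist_le dist_nonneg]
    intro z
    simp only [e, ContinuousMap.coe_mk, Real.dist_eq]
    exact abs_dist_sub_le x y z
  have hec : Continuous e := (LipschitzWith.mk_one he).continuous
  have hinj : Function.Injective e := fun x y h => by
    have := congrArg (fun F : C(X, ℝ) => F y) h
    simpa [e] using this
  obtain ⟨U, hU, heU, r, hr⟩ := hX.2 C(X, ℝ) e (hec.isClosedEmbedding hinj)
  classical
  let R : C(X, ℝ) → X := fun z => if h : z ∈ U then r ⟨z, h⟩ else Classical.arbitrary X
  have hRc : ∀ z ∈ U, ContinuousAt R z := by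
    intro z hz
    have : ContinuousOn R U := by
      rw [continuousOn_iff_continuous_domRestrict]
      have : U.domRestrict R = r := by
        funext z
        simp [R]
      rw [this]
      exact r.continuous
    exact this.continuousAt (hU.mem_nhds hz)
  have hRe : ∀ x, R (e x) = x := by
    intro x
    have hx : e x ∈ U := heU ⟨x, rfl⟩
    simp only [R, hx, dite_true]
    exact hr x hx
  refine ⟨e, he, R, fun ε hε => ?_⟩
  -- Continuity of `R` at each `e x` is made uniform by a Lebesgue number on the compact range of
  -- `e`.
  have hcov : ∀ x, ∃ ρ : ℝ, 0 < ρ ∧ ∀ z ∈ Metric.ball (e x) ρ, z ∈ U ∧ dist (R z) x < ε / 2 := by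
    intro x
    have hx : e x ∈ U := heU ⟨x, rfl⟩
    have h1 : ∀ᶠ z in 𝓝 (e x), dist (R z) x < ε / 2 := by
      have := Metric.tendsto_nhds.1 (hRc _ hx) (ε / 2) (by positivity)
      rwa [hRe] at this
    exact Metric.eventually_nhds_iff_ball.1 ((hU.eventually_mem hx).and h1)
  choose ρ hρ hρz using hcov
  obtain ⟨δ, hδ, hδx⟩ := lebesgue_number_lemma_of_metric (isCompact_range hec)
    (c := fun x => Metric.ball (e x) (ρ x)) (fun x => Metric.isOpen_ball) (by
      rintro _ ⟨x, rfl⟩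
      exact mem_iUnion.2 ⟨x, Metric.mem_ball_self (hρ x)⟩)
  refine ⟨δ, hδ, fun x z hz => ?_, hRe⟩
  obtain ⟨y, hy⟩ := hδx (e x) ⟨x, rfl⟩
  have h1 := hρz y z (hy hz)
  have h2 := (hρz y (e x) (hy (Metric.mem_ball_self hδ))).2
  rw [hRe] at h2
  refine ⟨hRc z h1.1, ?_⟩
  have := dist_triangle_right (R z) x y
  linarith [h1.2]

/-- Near each prescribed point, a bump function slides `e (f y)` linearly to `e (b a)` inside `C(X,
ℝ)`. The path stays near the image of `X`, where `r` brings it back. -/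
theorem IsANR.perturbationProperty {X : Type u} [MetricSpace X] [CompactSpace X]
    (hX : IsANR X) : PerturbationProperty X := by
  intro f ε hε
  rcases isEmpty_or_nonempty X with hem | hne
  · exact ⟨1, one_pos, fun s b _ => ⟨f, by simpa using hε, fun a => isEmptyElim a⟩⟩
  obtain ⟨e, he, r, hr⟩ := hX.exists_near_retraction
  obtain ⟨δ, hδ, hrδ, hre⟩ := hr (ε / 2) (by positivity)
  refine ⟨δ / 2, by positivity, fun s b hb => ?_⟩
  obtain ⟨ρ, hρ, hρs⟩ := exists_pos_lt_dist_of_finset s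
  obtain ⟨η, hη, hηf⟩ := Metric.uniformContinuous_iff.1
    (CompactSpace.uniformContinuous_of_continuous f.continuous) (δ / 2) (by positivity)
  obtain ⟨κ, hκ, hκρ, hκη⟩ : ∃ κ : ℝ, 0 < κ ∧ κ ≤ ρ / 2 ∧ κ ≤ η :=
    ⟨min (ρ / 2) η, by positivity, min_le_left _ _, min_le_right _ _⟩
  -- A bump equal to `1` within `κ / 2` of `a` and to `0` beyond `κ`. Since `κ ≤ ρ / 2`, at most one
  -- bump is nonzero at any point.
  let w : X → X → ℝ := fun a y => max 0 (min 1 (2 - 2 / κ * dist y a))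
  have hw0 : ∀ a y, κ ≤ dist y a → w a y = 0 := by
    intro a y h
    have : 2 ≤ 2 / κ * dist y a := by
      rw [div_mul_eq_mul_div, le_div_iff₀ hκ]; linarith
    exact max_eq_left ((min_le_right _ _).trans (by linarith))
  have hw1 : ∀ a y, dist y a ≤ κ / 2 → w a y = 1 := by
    intro a y h
    have : 2 / κ * dist y a ≤ 1 := by
      rw [div_mul_eq_mul_div, div_le_iff₀ hκ]; linarith
    have h2 : min 1 (2 - 2 / κ * dist y a) = 1 := min_eq_left (by linarith)
    simp [w, h2]
  have hwI : ∀ a y, |w a y| ≤ 1 := by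
    intro a y
    rw [abs_of_nonneg (le_max_left _ _)]
    exact max_le zero_le_one (min_le_left _ _)
  have hec : Continuous e := (LipschitzWith.mk_one he).continuous
  let G : X → C(X, ℝ) := fun y => e (f y) + ∑ a ∈ s, w a y • (e (b a) - e (f y))
  have hGc : Continuous G := by
    have hef : Continuous fun y => e (f y) := hec.comp f.continuous
    have hw : ∀ a, Continuous (w a) := fun a => by fun_prop
    exact hef.add (continuous_finsetSum _ fun a _ =>
      (hw a).smul ((continuous_const (y := e (b a))).sub hef))
  have hGa : ∀ a ∈ s, ∀ y, dist y a < κ → G y = e (f y) + w a y • (e (b a) - e (f y)) := by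
    intro a ha y hy
    simp only [G]
    rw [Finset.sum_eq_single_of_mem a ha]
    intro c hc hca
    rw [hw0 c y, zero_smul]
    have h1 := hρs a ha c hc hca.symm
    have h2 := dist_triangle_left a c y
    linarith
  have hGf : ∀ y, dist (G y) (e (f y)) < δ := by
    intro y
    by_cases h : ∃ a ∈ s, dist y a < κ
    · obtain ⟨a, ha, hy⟩ := h
      rw [hGa a ha y hy, dist_eq_norm, add_sub_cancel_left, norm_smul, Real.norm_eq_abs]
      calc |w a y| * ‖e (b a) - e (f y)‖ ≤ 1 * ‖e (b a) - e (f y)‖ := by gcongr; exact hwI a y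
        _ = dist (e (b a)) (e (f y)) := by rw [one_mul, dist_eq_norm]
        _ ≤ dist (b a) (f y) := he _ _
        _ ≤ dist (f a) (b a) + dist (f a) (f y) := dist_triangle_left _ _ _
        _ < δ / 2 + δ / 2 := add_lt_add (hb a ha) (by
            rw [dist_comm]; exact hηf (hy.trans_le hκη))
        _ = δ := by ring
    · push Not at h
      have : G y = e (f y) := by
        simp only [G]
        rw [Finset.sum_eq_zero, add_zero]
        intro a ha
        rw [hw0 a y (h a ha), zero_smul]
      rwa [this, dist_self]
  refine ⟨⟨fun y => r (G y), continuous_iff_continuousAt.2 fun y =>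
    ((hrδ _ _ (hGf y)).1).comp (f := G) hGc.continuousAt⟩, ?_, fun a ha => ?_⟩
  · rw [ContinuousMap.dist_lt_iff hε]
    intro y
    exact ((hrδ _ _ (hGf y)).2).trans (by linarith)
  · filter_upwards [Metric.ball_mem_nhds a (show 0 < κ / 2 by positivity)] with y hy
    have hy : dist y a < κ / 2 := hy
    simp only [ContinuousMap.coe_mk]
    rw [hGa a ha y (by linarith), hw1 a y hy.le, one_smul, add_sub_cancel, hre]

theorem LocallyKConnected.exists_uniform {X : Type*} [MetricSpace X] [CompactSpace X] {k : ℕ}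
    (hX : LocallyKConnected X k) {ε : ℝ} (hε : 0 < ε) : ∃ δ : ℝ, 0 < δ ∧ ∀ x : X,
      ∀ φ : C(Metric.sphere (0 : EuclideanSpace ℝ (Fin (k + 1))) 1, X),
        (∀ s, φ s ∈ Metric.ball x δ) →
        ∃ ψ : C(Metric.closedBall (0 : EuclideanSpace ℝ (Fin (k + 1))) 1, X),
          (∀ b, ψ b ∈ Metric.ball x ε) ∧
            ∀ s, ψ ⟨s.1, Metric.sphere_subset_closedBall s.2⟩ = φ s := by
  choose V hV hVU hφ using fun x : X =>
    hX x (Metric.ball x (ε / 2)) (Metric.ball_mem_nhds x (by positivity))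
  obtain ⟨δ, hδ, hδx⟩ := lebesgue_number_lemma_of_metric (isCompact_univ (X := X))
    (c := fun x => interior (V x)) (fun x => isOpen_interior)
    fun x _ => mem_iUnion.2 ⟨x, mem_interior_iff_mem_nhds.2 (hV x)⟩
  refine ⟨δ, hδ, fun x φ hφx => ?_⟩
  obtain ⟨y, hy⟩ := hδx x (mem_univ x)
  obtain ⟨ψ, h1, h2⟩ := hφ y φ fun s => interior_subset (hy (hφx s))
  refine ⟨ψ, fun b => ?_, h2⟩
  have hxy : dist x y < ε / 2 := hVU y (interior_subset (hy (Metric.mem_ball_self hδ)))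
  have := dist_triangle_right (ψ b) x y
  have hb : dist (ψ b) y < ε / 2 := h1 b
  exact Metric.mem_ball.2 (by linarith)

/-- The `n`-skeleton of the simplicial complex `K`, inside the standard simplex. -/
def skeleton {ι : Type*} [Fintype ι] (K : Set (Finset ι)) (n : ℕ) : Set (ι → ℝ) :=
  ⋃ σ : {σ : Finset ι // σ ∈ K ∧ σ.card ≤ n + 1}, face σ.1

theorem face_subset_skeleton {ι : Type*} [Fintype ι] {K : Set (Finset ι)} {n : ℕ} {σ : Finset ι}
    (hσ : σ ∈ K) (hc : σ.card ≤ n + 1) : face σ ⊆ skeleton K n :=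
  subset_iUnion (fun σ : {σ : Finset ι // σ ∈ K ∧ σ.card ≤ n + 1} => face σ.1) ⟨σ, hσ, hc⟩

theorem faceBoundary_subset {ι : Type*} [Fintype ι] {σ : Finset ι} {t : ι → ℝ}
    (ht : t ∈ faceBoundary σ) : ∃ τ ⊂ σ, t ∈ face τ := by
  classical
  obtain ⟨ht, i, hi, hti⟩ := ht
  refine ⟨σ.erase i, Finset.erase_ssubset hi, ht.1, ht.2.1, fun j hj => ?_⟩
  by_cases hji : j = i
  · rw [hji, hti]
  · exact ht.2.2 j fun h => hj (Finset.mem_erase.2 ⟨hji, h⟩)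

theorem support_subset_of_mem_face {ι : Type*} [Fintype ι] {σ : Finset ι} {t : ι → ℝ}
    (ht : t ∈ face σ) : Finset.univ.filter (fun i => t i ≠ 0) ⊆ σ := by
  intro i hi
  by_contra h
  exact (Finset.mem_filter.1 hi).2 (ht.2.2 i h)

theorem mem_face_support {ι : Type*} [Fintype ι] {σ : Finset ι} {t : ι → ℝ}
    (ht : t ∈ face σ) : t ∈ face (Finset.univ.filter (fun i => t i ≠ 0)) :=
  ⟨ht.1, ht.2.1, fun i hi => by simpa using hi⟩

theorem eq_single_of_mem_face {ι : Type*} [Fintype ι] [DecidableEq ι] {σ : Finset ι} {t : ι → ℝ}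
    {i : ι} (ht : t ∈ face σ) (hi : ∀ j ≠ i, t j = 0) : t = Pi.single i 1 := by
  have h1 := ht.2.1
  rw [Finset.sum_eq_single i (fun j _ hj => hi j hj) (by simp)] at h1
  funext j
  by_cases hj : j = i
  · subst hj; simpa using h1
  · rw [hi j hj, Pi.single_eq_of_ne hj]

theorem exists_eq_single_of_mem_face {ι : Type*} [Fintype ι] [DecidableEq ι] {σ : Finset ι}
    {t : ι → ℝ} (hσ : σ.card ≤ 1) (ht : t ∈ face σ) : ∃ i ∈ σ, t = Pi.single i 1 := by
  rcases σ.eq_empty_or_nonempty with rfl | ⟨i, hi⟩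
  · have h := ht.2.1
    rw [Finset.sum_eq_zero fun i _ => ht.2.2 i (by simp)] at h
    exact absurd h zero_ne_one
  · exact ⟨i, hi, eq_single_of_mem_face ht fun j hj =>
      ht.2.2 j fun hjσ => hj (Finset.card_le_one.1 hσ j hjσ i hi)⟩

/-- Maps with small simplex images defined on the vertices of a finite simplicial complex extend
to its `n`-skeleton with control if the target is `LC^{n-1}`. -/
theorem exists_map_skeleton {X : Type*} [MetricSpace X] [CompactSpace X] (n : ℕ)
    (hX : ∀ k < n, LocallyKConnected X k) : ∀ ε : ℝ, 0 < ε → ∃ δ : ℝ, 0 < δ ∧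
      ∀ (ι : Type u) [Fintype ι] [DecidableEq ι] (K : Set (Finset ι))
        (_ : ∀ σ ∈ K, ∀ τ ⊆ σ, τ ∈ K) (y : Finset ι → X) (v : ι → X)
        (_ : ∀ σ ∈ K, ∀ i ∈ σ, dist (v i) (y σ) < δ)
        (_ : ∀ σ ∈ K, ∀ τ ⊆ σ, τ.Nonempty → dist (y τ) (y σ) < δ),
        ∃ p : (ι → ℝ) → X, ContinuousOn p (skeleton K n) ∧ (∀ i, p (Pi.single i 1) = v i) ∧
          ∀ σ ∈ K, ∀ t ∈ face σ ∩ skeleton K n, dist (p t) (y σ) < ε := by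
  induction n with
  | zero =>
    refine fun ε hε => ⟨ε, hε, fun ι _ _ K _ y v hv _ => ?_⟩
    have hp : ∀ i, (if h : ∃ j, (Pi.single i 1 : ι → ℝ) = Pi.single j 1 then v h.choose else y ∅)
        = v i := by
      intro i
      have h : ∃ j, (Pi.single i 1 : ι → ℝ) = Pi.single j 1 := ⟨i, rfl⟩
      rw [dif_pos h]
      congr 1
      by_contra hne
      have h1 := congrFun h.choose_spec i
      rw [Pi.single_eq_same, Pi.single_eq_of_ne (Ne.symm hne)] at h1
      exact one_ne_zero h1
    classical
    refine ⟨fun t => if h : ∃ j, t = Pi.single j 1 then v h.choose else y ∅, ?_, ?_, ?_⟩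
    · refine (locallyFinite_of_finite _).continuousOn_iUnion (fun σ => isClosed_face σ.1) ?_
      rintro ⟨σ, hσ, hc⟩
      refine Set.Subsingleton.continuousOn ?_ _
      intro t ht t' ht'
      obtain ⟨i, hi, rfl⟩ := exists_eq_single_of_mem_face hc ht
      obtain ⟨j, hj, rfl⟩ := exists_eq_single_of_mem_face hc ht'
      rw [Finset.card_le_one.1 hc i hi j hj]
    · intro i
      convert hp i
    · rintro σ hσ t ⟨ht, ht'⟩
      obtain ⟨⟨τ, hτ, hc⟩, htτ⟩ := mem_iUnion.1 ht'
      obtain ⟨i, hi, rfl⟩ := exists_eq_single_of_mem_face hc htτ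
      have hiσ : i ∈ σ := by
        by_contra h
        have := ht.2.2 i h
        simp at this
      have := hv σ hσ i hiσ
      rw [← hp i] at this
      convert this
  | succ n ih =>
    intro ε hε
    -- Constants are chosen downwards: the boundary of an `(n + 1)`-simplex `σ` must land within
    -- `δ₁` of `y σ` to be filled within `ε / 2`. The other `ε / 2` pays for passing from `y τ` to
    -- `y σ` when `τ ⊆ σ`.
    obtain ⟨δ₁, hδ₁, hLC⟩ := (hX n n.lt_succ_self).exists_uniform (half_pos hε)
    obtain ⟨δ₀, hδ₀, H⟩ := ih (fun k hk => hX k (hk.trans n.lt_succ_self)) (min δ₁ (ε / 2))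
      (by positivity)
    refine ⟨min δ₀ (ε / 2), by positivity, fun ι _ _ K hK y v hv hy => ?_⟩
    obtain ⟨p, hpc, hpv, hpy⟩ := H ι K hK y v
      (fun σ hσ i hi => (hv σ hσ i hi).trans_le (min_le_left _ _))
      (fun σ hσ τ hτ hne => (hy σ hσ τ hτ hne).trans_le (min_le_left _ _))
    have hbd : ∀ σ ∈ K, σ.card = n + 2 → faceBoundary σ ⊆ skeleton K n := by
      intro σ hσ hc t ht
      obtain ⟨τ, hτ, htτ⟩ := faceBoundary_subset ht
      have := Finset.card_lt_card hτ
      exact face_subset_skeleton (hK σ hσ τ hτ.subset) (by omega) htτ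
    have hext : ∀ σ, ∃ q : (ι → ℝ) → X, σ ∈ K → σ.card = n + 2 →
        ContinuousOn q (face σ) ∧ MapsTo q (face σ) (Metric.ball (y σ) (ε / 2)) ∧
          ∀ t ∈ faceBoundary σ, q t = p t := by
      intro σ
      by_cases h : σ ∈ K ∧ σ.card = n + 2
      · obtain ⟨q, hq⟩ := exists_extension_face σ h.2 (hLC (y σ)) p
          (hpc.mono (hbd σ h.1 h.2))
          (fun t ht => (hpy σ h.1 t ⟨ht.1, hbd σ h.1 h.2 ht⟩).trans_le (min_le_left _ _))
        exact ⟨q, fun _ _ => hq⟩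
      · exact ⟨p, fun h1 h2 => absurd ⟨h1, h2⟩ h⟩
    choose q hq using hext
    let supp : (ι → ℝ) → Finset ι := fun t => Finset.univ.filter (fun i => t i ≠ 0)
    -- Each point uses the filling of the simplex spanned by its support. Fillings agree with `p` on
    -- boundaries, so on every closed face `P` is a single continuous map, and finitely many closed
    -- faces glue.
    let P : (ι → ℝ) → X := fun t => if (supp t).card = n + 2 then q (supp t) t else p t
    have hPp : ∀ σ : Finset ι, σ.card ≤ n + 1 → ∀ t ∈ face σ, P t = p t := by
      intro σ hc t ht
      have := Finset.card_le_card (support_subset_of_mem_face ht)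
      exact if_neg (show (supp t).card ≠ n + 2 by simp only [supp]; omega)
    have hPq : ∀ σ ∈ K, σ.card = n + 2 → ∀ t ∈ face σ, P t = q σ t := by
      intro σ hσ hc t ht
      have hsub : supp t ⊆ σ := support_subset_of_mem_face ht
      by_cases h : (supp t).card = n + 2
      · have : supp t = σ := Finset.eq_of_subset_of_card_le hsub (by omega)
        simp only [P, h, if_true]
        rw [this]
      · simp only [P, h, if_false]
        refine ((hq σ hσ hc).2.2 t ⟨ht, ?_⟩).symm
        by_contra hcon
        push Not at hcon
        apply h
        rw [← hc]
        congr 1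
        exact subset_antisymm hsub fun i hi => by simpa [supp] using hcon i hi
    refine ⟨P, ?_, ?_, ?_⟩
    · refine (locallyFinite_of_finite _).continuousOn_iUnion (fun σ => isClosed_face σ.1) ?_
      rintro ⟨σ, hσ, hc⟩
      by_cases h : σ.card = n + 2
      · exact (hq σ hσ h).1.congr (hPq σ hσ h)
      · have hc' : σ.card ≤ n + 1 := by omega
        exact (hpc.mono (face_subset_skeleton hσ hc')).congr (hPp σ hc')
    · intro i
      rw [← hpv i]
      refine hPp {i} (by simp) _ ⟨fun j => ?_, by simp, fun j hj => ?_⟩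
      · by_cases hj : j = i
        · subst hj; simp
        · simp [Pi.single_eq_of_ne hj]
      · exact Pi.single_eq_of_ne (by simpa using hj) _
    · rintro σ hσ t ⟨ht, ht'⟩
      obtain ⟨⟨σ', hσ', hc'⟩, htσ'⟩ := mem_iUnion.1 ht'
      have hcard : (supp t).card ≤ n + 2 :=
        (Finset.card_le_card (support_subset_of_mem_face htσ')).trans hc'
      have hsub : supp t ⊆ σ := support_subset_of_mem_face ht
      have hτ : supp t ∈ K := hK σ hσ _ hsub
      have htτ : t ∈ face (supp t) := mem_face_support ht
      by_cases h : (supp t).card = n + 2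
      · rw [hPq _ hτ h t htτ]
        have h1 : dist (q (supp t) t) (y (supp t)) < ε / 2 := (hq _ hτ h).2.1 htτ
        have h2 := (hy σ hσ _ hsub (Finset.card_pos.1 (by omega))).trans_le (min_le_right _ _)
        have := dist_triangle (q (supp t) t) (y (supp t)) (y σ)
        linarith
      · have hc : (supp t).card ≤ n + 1 := by omega
        rw [hPp _ hc t htτ]
        have := (hpy σ hσ t ⟨ht, face_subset_skeleton hτ hc htτ⟩).trans_le (min_le_right _ _)
        linarith

/-- A partition of unity maps `X` to the nerve of a fine cover, of dimension at most `n`, and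
`exists_map_skeleton` maps the nerve back to `X` close to `f`. If only one member of the cover meets
a ball about `a`, the composite is constant there, with the value chosen at that vertex. -/
theorem CoverMultiplicityLE.perturbationProperty {X : Type u} [MetricSpace X] [CompactSpace X]
    {n : ℕ} (hdim : CoverMultiplicityLE X (n + 1)) (hX : ∀ k < n, LocallyKConnected X k) :
    PerturbationProperty X := by
  classical
  intro f ε hε
  rcases isEmpty_or_nonempty X with hem | hne
  · exact ⟨1, one_pos, fun s b _ => ⟨f, by simpa using hε, fun a => isEmptyElim a⟩⟩
  obtain ⟨δ, hδ, hskel⟩ := exists_map_skeleton.{u} n hX (ε / 2) (half_pos hε)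
  refine ⟨δ / 2, half_pos hδ, fun s b hb => ?_⟩
  obtain ⟨ρ, hρ, hρs⟩ := exists_pos_lt_dist_of_finset s
  obtain ⟨η, hη, hηf⟩ := Metric.uniformContinuous_iff.1
    (CompactSpace.uniformContinuous_of_continuous f.continuous) (min (δ / 2) (ε / 2))
    (by positivity)
  obtain ⟨κ, hκ, hκρ, hκη⟩ : ∃ κ : ℝ, 0 < κ ∧ κ ≤ ρ / 2 ∧ κ ≤ η / 2 :=
    ⟨min (ρ / 2) (η / 2), by positivity, min_le_left _ _, min_le_right _ _⟩
  obtain ⟨F, hF⟩ := isCompact_univ.elim_finite_subcover (fun x : X => Metric.ball x κ)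
    (fun x => Metric.isOpen_ball) fun x _ => mem_iUnion.2 ⟨x, Metric.mem_ball_self hκ⟩
  obtain ⟨𝒱, h𝒱fin, h𝒱o, h𝒱cov, h𝒱ref, h𝒱mult⟩ := hdim ((fun x => Metric.ball x κ) '' F)
    (F.finite_toSet.image _) (by rintro _ ⟨x, -, rfl⟩; exact Metric.isOpen_ball) (by
      rw [sUnion_image]; exact univ_subset_iff.1 hF)
  have hsmall : ∀ V ∈ 𝒱, ∀ x ∈ V, ∀ y ∈ V, dist x y < 2 * κ := by
    intro V hV x hx y hy
    obtain ⟨_, ⟨z, -, rfl⟩, hz⟩ := h𝒱ref V hV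
    have h1 : dist x z < κ := hz hx
    have h2 : dist y z < κ := hz hy
    have := dist_triangle_right x y z
    linarith
  have hfsmall : ∀ V ∈ 𝒱, ∀ x ∈ V, ∀ y ∈ V, dist (f x) (f y) < min (δ / 2) (ε / 2) :=
    fun V hV x hx y hy => hηf ((hsmall V hV x hx y hy).trans_le (by linarith))
  have : Fintype 𝒱 := h𝒱fin.fintype
  have hW : ∀ x, ∃ V : 𝒱, x ∈ V.1 := by
    intro x
    have : x ∈ ⋃₀ 𝒱 := h𝒱cov ▸ mem_univ x
    obtain ⟨V, hV, hx⟩ := this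
    exact ⟨⟨V, hV⟩, hx⟩
  choose W hW using hW
  obtain ⟨r, hr, hrρ, hrW⟩ : ∃ r : ℝ, 0 < r ∧ r ≤ ρ / 2 ∧
      ∀ a ∈ s, Metric.closedBall a r ⊆ (W a).1 := by
    have h1 : ∀ᶠ r : ℝ in 𝓝[>] 0, ∀ a ∈ s, Metric.closedBall a r ⊆ (W a).1 := by
      refine (s.eventually_all).2 fun a _ => ?_
      obtain ⟨r, hr, hrW⟩ := Metric.nhds_basis_closedBall.mem_iff.1
        ((h𝒱o _ (W a).2).mem_nhds (hW a))
      filter_upwards [(eventually_lt_nhds hr).filter_mono nhdsWithin_le_nhds] with r' hr'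
      exact (Metric.closedBall_subset_closedBall hr'.le).trans hrW
    have h2 : ∀ᶠ r : ℝ in 𝓝[>] 0, r < ρ / 2 :=
      (eventually_lt_nhds (half_pos hρ)).filter_mono nhdsWithin_le_nhds
    obtain ⟨r, h1, h2, h3⟩ := (h1.and (h2.and self_mem_nhdsWithin)).exists
    exact ⟨r, h3, h2.le, h1⟩
  -- Shrinking the cover: the ball about `a` is removed from every member except `W a`.
  let T : 𝒱 → Set X := fun V => V.1 \ ⋃ a ∈ s.filter (fun a => W a ≠ V), Metric.closedBall a r
  have hTo : ∀ V, IsOpen (T V) := fun V => (h𝒱o V.1 V.2).sdiff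
    (isClosed_biUnion_finset fun a _ => Metric.isClosed_closedBall)
  have hTsub : ∀ V, T V ⊆ V.1 := fun V => sdiff_subset
  have hTunique : ∀ a ∈ s, ∀ x ∈ Metric.closedBall a r, ∀ V, x ∈ T V → V = W a := by
    intro a ha x hx V hxV
    by_contra hne
    exact hxV.2 (mem_biUnion (Finset.mem_filter.2 ⟨ha, Ne.symm hne⟩) hx)
  have hTcov : ∀ x, ∃ V, x ∈ T V := by
    intro x
    by_cases h : ∃ a ∈ s, x ∈ Metric.closedBall a r
    · obtain ⟨a, ha, hx⟩ := h
      refine ⟨W a, hrW a ha hx, fun hcon => ?_⟩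
      obtain ⟨c, hc, hxc⟩ := mem_iUnion₂.1 hcon
      obtain ⟨hcs, hca⟩ := Finset.mem_filter.1 hc
      have h1 := hρs a ha c hcs (fun h => hca (by rw [h]))
      have h2 := dist_triangle_left a c x
      rw [Metric.mem_closedBall] at hx hxc
      linarith
    · push Not at h
      refine ⟨W x, hW x, fun hcon => ?_⟩
      obtain ⟨c, hc, hxc⟩ := mem_iUnion₂.1 hcon
      exact h c (Finset.mem_filter.1 hc).1 hxc
  obtain ⟨φ, hφ⟩ := PartitionOfUnity.exists_isSubordinate isClosed_univ T hTo
    fun x _ => mem_iUnion.2 (hTcov x)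
  -- A member is assigned to at most one point of `s`: two points of `s` are more than `ρ` apart,
  -- while two points of a member are less than `2 * κ ≤ ρ` apart.
  have hv : ∀ V : 𝒱, ∃ w : X, (∀ a ∈ s, W a = V → w = b a) ∧ ∀ x ∈ T V, dist w (f x) < δ := by
    intro V
    by_cases h : ∃ a ∈ s, W a = V
    · obtain ⟨a, ha, rfl⟩ := h
      refine ⟨b a, fun c hc hca => ?_, fun x hx => ?_⟩
      · by_contra hne
        have h1 := hρs a ha c hc (fun h => hne (by rw [h]))
        have h2 := hsmall _ (W a).2 a (hW a) c (hca ▸ hW c)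
        linarith
      · have h1 := hb a ha
        have h2 := (hfsmall _ (W a).2 a (hW a) x (hTsub _ hx)).trans_le (min_le_left _ _)
        have h3 := dist_triangle_left (b a) (f x) (f a)
        linarith
    · push Not at h
      rcases (T V).eq_empty_or_nonempty with hE | ⟨x₀, hx₀⟩
      · exact ⟨Classical.arbitrary X, fun a ha hav => absurd hav (h a ha), by simp [hE]⟩
      · refine ⟨f x₀, fun a ha hav => absurd hav (h a ha), fun x hx => ?_⟩
        have := (hfsmall _ V.2 x₀ (hTsub _ hx₀) x (hTsub _ hx)).trans_le (min_le_left _ _)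
        linarith
  choose v hvb hvf using hv
  -- The nerve of the shrunken cover. The reference value of a simplex `σ` is `f (z σ)`, with `z σ`
  -- a common point of its members.
  let K : Set (Finset 𝒱) := {σ | ∃ x, ∀ i ∈ σ, x ∈ T i}
  have hz : ∀ σ : Finset 𝒱, ∃ z : X, σ ∈ K → ∀ i ∈ σ, z ∈ T i := by
    intro σ
    by_cases h : σ ∈ K
    · exact ⟨h.choose, fun _ => h.choose_spec⟩
    · exact ⟨Classical.arbitrary X, fun h' => absurd h' h⟩
  choose z hz using hz
  have hK : ∀ σ ∈ K, ∀ τ ⊆ σ, τ ∈ K := fun σ ⟨x, hx⟩ τ hτ => ⟨x, fun i hi => hx i (hτ hi)⟩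
  have hzf : ∀ σ ∈ K, ∀ i ∈ σ, ∀ x ∈ T i, dist (f (z σ)) (f x) < min (δ / 2) (ε / 2) :=
    fun σ hσ i hi x hx => hfsmall _ i.2 _ (hTsub _ (hz σ hσ i hi)) _ (hTsub _ hx)
  obtain ⟨p, hpc, hpv, hpy⟩ := hskel 𝒱 K hK (fun σ => f (z σ)) v
    (fun σ hσ i hi => hvf i _ (hz σ hσ i hi))
    (fun σ hσ τ hτ ⟨i, hi⟩ => ((hzf τ (hK σ hσ τ hτ) i hi _ (hz σ hσ i (hτ hi))).trans_le
      (min_le_left _ _)).trans (by linarith))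
  let c : X → 𝒱 → ℝ := fun x i => φ i x
  have hcc : Continuous c := continuous_pi fun i => (φ i).continuous
  let S : X → Finset 𝒱 := fun x => Finset.univ.filter fun i => x ∈ T i
  have hSK : ∀ x, S x ∈ K := fun x => ⟨x, fun i hi => (Finset.mem_filter.1 hi).2⟩
  have hcT : ∀ x i, x ∉ T i → c x i = 0 := by
    intro x i hi
    by_contra h
    exact hi (hφ i (subset_tsupport _ h))
  have hcS : ∀ x, c x ∈ face (S x) := by
    intro x
    refine ⟨fun i => φ.nonneg i x, ?_, fun i hi => hcT x i fun h => hi (by simpa [S] using h)⟩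
    have := φ.sum_eq_one (mem_univ x)
    rwa [finsum_eq_sum_of_fintype] at this
  have hcard : ∀ x, (S x).card ≤ n + 1 := by
    intro x
    have h1 : ((S x).map (Function.Embedding.subtype _) : Set (Set X)) ⊆ {V ∈ 𝒱 | x ∈ V} := by
      intro V hV
      obtain ⟨i, hi, rfl⟩ := Finset.mem_map.1 (Finset.mem_coe.1 hV)
      exact ⟨i.2, hTsub i (Finset.mem_filter.1 hi).2⟩
    have h2 := (encard_le_encard h1).trans (h𝒱mult x)
    rw [encard_coe_eq_coe_finsetCard, Finset.card_map] at h2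
    exact_mod_cast h2
  have hcskel : ∀ x, c x ∈ skeleton K n := fun x =>
    face_subset_skeleton (hSK x) (hcard x) (hcS x)
  refine ⟨⟨fun x => p (c x), hpc.comp_continuous hcc hcskel⟩, ?_, fun a ha => ?_⟩
  · rw [ContinuousMap.dist_lt_iff hε]
    intro x
    obtain ⟨i, hi⟩ := hTcov x
    have h1 := hpy (S x) (hSK x) (c x) ⟨hcS x, hcskel x⟩
    have h2 := (hzf (S x) (hSK x) i (by simpa [S] using hi) x hi).trans_le (min_le_right _ _)
    have := dist_triangle (p (c x)) (f (z (S x))) (f x)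
    simp only [ContinuousMap.coe_mk]
    linarith
  · filter_upwards [Metric.closedBall_mem_nhds a hr] with x hx
    have h1 : c x = Pi.single (W a) 1 := eq_single_of_mem_face (hcS x) fun j hj =>
      hcT x j fun h => hj (hTunique a ha x hx j h)
    simp only [ContinuousMap.coe_mk]
    rw [h1, hpv, hvb _ a ha rfl]

end Perturbation

/-! ### Locally constant cycles and the generic conclusions. -/

section Cycles

variable {X : Type*} [MetricSpace X]

/-- Balls in a perfect space are infinite, so each new point can avoid the earlier ones.
Distinctness allows a different value to be prescribed at each visit of a chain to the same place.
-/
theorem exists_injOn_near [PerfectSpace X] (c : ℕ → X) {ρ : ℕ → ℝ} (hρ : ∀ i, 0 < ρ i) (N : ℕ) :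
    ∃ a : ℕ → X, (∀ i < N, dist (a i) (c i) < ρ i) ∧ InjOn a (Iio N) := by
  induction N with
  | zero => exact ⟨c, by simp, by simp⟩
  | succ N ih =>
    obtain ⟨a, ha, hinj⟩ := ih
    obtain ⟨z, hz, hza⟩ := ((infinite_of_mem_nhds (c N) (Metric.ball_mem_nhds (c N) (hρ N))).sdiff
      ((finite_Iio N).image a)).nonempty
    refine ⟨Function.update a N z, fun i hi => ?_, ?_⟩
    · by_cases h : i = N
      · subst h; simpa using hz
      · rw [Function.update_of_ne h]; exact ha i (by omega)
    · have hne : ∀ i < N, Function.update a N z i = a i := fun i hi =>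
        Function.update_of_ne hi.ne _ _
      intro i hi j hj hij
      have hi : i < N + 1 := hi
      have hj : j < N + 1 := hj
      rcases Nat.lt_succ_iff_lt_or_eq.1 hi with hi | rfl <;>
        rcases Nat.lt_succ_iff_lt_or_eq.1 hj with hj | rfl
      · rw [hne i hi, hne j hj] at hij; exact hinj hi hj hij
      · rw [hne i hi, Function.update_self] at hij; exact absurd ⟨i, hi, hij⟩ hza
      · rw [hne j hj, Function.update_self] at hij; exact absurd ⟨j, hj, hij.symm⟩ hza
      · rfl

/-- `g` is locally constant along the cycle `a 0 ↦ a 1 ↦ ⋯ ↦ a (N - 1) ↦ a 0`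
of `N` distinct points. -/
structure IsLocallyConstantCycle (g : X → X) (N : ℕ) (a : ℕ → X) : Prop where
  injOn : InjOn a (Iio N)
  eventually_eq : ∀ i < N, ∀ᶠ y in 𝓝 (a i), g y = a ((i + 1) % N)

variable [CompactSpace X]

theorem PerturbationProperty.exists_cycle [PerfectSpace X] (hX : PerturbationProperty X)
    (f : C(X, X)) {x : X} (hx : x ∈ chainRecurrent f) {V : Set X} (hV : V ∈ 𝓝 x) {ε : ℝ}
    (hε : 0 < ε) (l : ℕ) : ∃ g : C(X, X), dist g f < ε ∧ ∃ (N : ℕ) (a : ℕ → X),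
      l ≤ N ∧ IsLocallyConstantCycle g N a ∧ a 0 ∈ V ∧ ∃ n < N, n ≠ 0 ∧ a n ∈ V := by
  obtain ⟨δ, hδ, hfδ⟩ := hX f ε hε
  obtain ⟨n, c, hn, hc0, hcn, hc⟩ := hx (δ / 3) (by positivity)
  obtain ⟨r, hr, hrV⟩ := Metric.mem_nhds_iff.1 hV
  let d : ℕ → X := fun i => c (i % n)
  have hd : ∀ i, dist (f (d i)) (d (i + 1)) < δ / 3 := by
    intro i
    have hlt := Nat.mod_lt i hn
    have h1 := hc (i % n) hlt
    have h2 : c (i % n + 1) = d (i + 1) := by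
      simp only [d, Nat.add_mod i 1 n]
      by_cases h : i % n + 1 = n
      · rw [h, hcn]
        rcases Nat.lt_or_ge 1 n with h1 | h1
        · rw [Nat.mod_eq_of_lt h1, h, Nat.mod_self, hc0]
        · obtain rfl : n = 1 := by omega
          simp [Nat.mod_one, hc0]
      · rw [Nat.mod_eq_of_lt (show 1 < n by omega), Nat.mod_eq_of_lt (by omega : i % n + 1 < n)]
    rwa [← h2]
  obtain ⟨η, hη, hηf⟩ := Metric.uniformContinuous_iff.1
    (CompactSpace.uniformContinuous_of_continuous f.continuous) (δ / 3) (by positivity)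
  -- At least two rounds of the chain are needed, so that `a 0` and `a n` are distinct cycle points
  -- near `x`; the term `l` ensures `l ≤ N`.
  let N := n * (l + 2)
  obtain ⟨a, ha, hinj⟩ := exists_injOn_near d (ρ := fun _ => min r (min η (δ / 3)))
    (fun _ => by positivity) N
  have hN : 0 < N := by positivity
  have hclose : ∀ i < N, dist (f (a i)) (a ((i + 1) % N)) < δ := by
    intro i hi
    have h1 := hηf ((ha i hi).trans_le ((min_le_right _ _).trans (min_le_left _ _)))
    have h2 := hd i
    have h3 := (ha _ (Nat.mod_lt (i + 1) hN)).trans_le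
      ((min_le_right _ _).trans (min_le_right _ _))
    have h4 : d ((i + 1) % N) = d (i + 1) := by
      simp only [d, N, Nat.mod_mod_of_dvd _ (Nat.dvd_mul_right n (l + 2))]
    rw [h4, dist_comm] at h3
    have := dist_triangle4 (f (a i)) (f (d i)) (d (i + 1)) (a ((i + 1) % N))
    linarith
  have hinv : ∀ i < N, Function.invFunOn a (Iio N) (a i) = i := fun i hi =>
    hinj.leftInvOn_invFunOn hi
  classical
  obtain ⟨g, hgf, hg⟩ := hfδ ((Finset.range N).image a)
    (fun y => a ((Function.invFunOn a (Iio N) y + 1) % N)) (by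
      intro y hy
      obtain ⟨i, hi, rfl⟩ := Finset.mem_image.1 hy
      have hi := Finset.mem_range.1 hi
      simp only [hinv i hi]
      exact hclose i hi)
  have haV : ∀ i < N, i % n = 0 → a i ∈ V := by
    intro i hi h0
    have := (ha i hi).trans_le (min_le_left _ _)
    simp only [d, h0, hc0] at this
    exact hrV this
  have hnN : n < N := by simp only [N]; nlinarith
  refine ⟨g, hgf, N, a, ?_, ⟨hinj, fun i hi => ?_⟩, haV 0 hN (by simp), n, hnN, by omega,
    haV n hnN (by simp)⟩
  · simp only [N]; nlinarith
  · have := hg (a i) (Finset.mem_image_of_mem a (Finset.mem_range.2 hi))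
    simpa only [hinv i hi] using this

/-- Maps near `g` follow a locally constant cycle of `g`. -/
theorem IsLocallyConstantCycle.exists_pos {g : C(X, X)} {N : ℕ} {a : ℕ → X}
    (h : IsLocallyConstantCycle g N a) {ε : ℝ} (hε : 0 < ε) : ∃ r : ℝ, 0 < r ∧ r ≤ ε ∧
      (∀ i < N, ∀ j < N, i ≠ j → 2 * r < dist (a i) (a j)) ∧
      ∀ r' : ℝ, 0 < r' → r' ≤ r → ∀ᶠ f : C(X, X) in 𝓝 g, ∀ i < N, ∀ y ∈ Metric.closedBall (a i) r,
        ∀ k : ℕ, 1 ≤ k → f^[k] y ∈ Metric.ball (a ((i + k) % N)) r' := by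
  have h1 : ∀ᶠ r : ℝ in 𝓝[>] 0, ∀ i ∈ Finset.range N, ∀ y ∈ Metric.closedBall (a i) r,
      g y = a ((i + 1) % N) := by
    refine ((Finset.range N).eventually_all).2 fun i hi => ?_
    obtain ⟨r, hr, hrg⟩ := Metric.nhds_basis_closedBall.mem_iff.1
      (h.eventually_eq i (Finset.mem_range.1 hi))
    filter_upwards [(eventually_lt_nhds hr).filter_mono nhdsWithin_le_nhds] with r' hr' y hy
    exact hrg (Metric.closedBall_subset_closedBall hr'.le hy)
  have h2 : ∀ᶠ r : ℝ in 𝓝[>] 0, ∀ i ∈ Finset.range N, ∀ j ∈ Finset.range N, i ≠ j →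
      2 * r < dist (a i) (a j) := by
    refine ((Finset.range N).eventually_all).2 fun i hi =>
      ((Finset.range N).eventually_all).2 fun j hj => ?_
    by_cases hij : i = j
    · exact Eventually.of_forall fun _ h => absurd hij h
    · have hpos : 0 < dist (a i) (a j) := dist_pos.2 fun hcon =>
        hij (h.injOn (Finset.mem_range.1 hi) (Finset.mem_range.1 hj) hcon)
      filter_upwards [(eventually_lt_nhds (half_pos hpos)).filter_mono nhdsWithin_le_nhds]
        with r hr _
      linarith
  have h3 : ∀ᶠ r : ℝ in 𝓝[>] 0, r < ε := (eventually_lt_nhds hε).filter_mono nhdsWithin_le_nhds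
  obtain ⟨r, h1, h2, h3, hr⟩ := (h1.and (h2.and (h3.and self_mem_nhdsWithin))).exists
  simp only [Finset.mem_range] at h1 h2
  refine ⟨r, hr, h3.le, h2, fun r' hr' hle => ?_⟩
  -- As `g` is constant on each `r`-ball, `f` sends that ball within `r'` of the next cycle point;
  -- `r' ≤ r` lets this be iterated without accumulating error.
  filter_upwards [Metric.ball_mem_nhds g hr'] with f hf i hi y hy
  have step : ∀ i < N, ∀ y ∈ Metric.closedBall (a i) r,
      f y ∈ Metric.ball (a ((i + 1) % N)) r' := by
    intro i hi y hy
    rw [← h1 i hi y hy]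
    exact (ContinuousMap.dist_apply_le_dist y).trans_lt hf
  intro k hk
  induction k, hk using Nat.le_induction with
  | base => exact step i hi y hy
  | succ k hk ih =>
    rw [Function.iterate_succ_apply']
    have := step _ (Nat.mod_lt (i + k) (by omega)) _
      (Metric.ball_subset_closedBall (Metric.ball_subset_ball hle ih))
    rwa [Nat.mod_add_mod] at this

/-- Near a map with a locally constant cycle, every map has two distinct chain recurrent points
near two given points of the cycle. -/
theorem IsLocallyConstantCycle.eventually_nontrivial {g : C(X, X)} {N : ℕ} {a : ℕ → X}
    (h : IsLocallyConstantCycle g N a) {V : Set X} (hV : IsOpen V) {i j : ℕ} (hi : i < N)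
    (hj : j < N) (hij : i ≠ j) (hiV : a i ∈ V) (hjV : a j ∈ V) :
    ∀ᶠ f : C(X, X) in 𝓝 g, (chainRecurrent f ∩ V).Nontrivial := by
  obtain ⟨ε, hε, hεV⟩ := Metric.isOpen_iff.1 hV _ hiV
  obtain ⟨ε', hε', hεV'⟩ := Metric.isOpen_iff.1 hV _ hjV
  obtain ⟨r, hr, hrε, hsep, hev⟩ := h.exists_pos (ε := min ε ε' / 2) (by positivity)
  have hpos : 0 < min ε ε' := by positivity
  filter_upwards [hev r hr le_rfl] with f hf
  have key : ∀ m < N, ∃ x ∈ Metric.closedBall (a m) r, x ∈ chainRecurrent f := by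
    intro m hm
    refine exists_mem_chainRecurrent_of_mapsTo f Metric.isClosed_closedBall
      ⟨a m, Metric.mem_closedBall_self hr.le⟩ (n := N) (by omega) fun y hy => ?_
    have := hf m hm y hy N (by omega)
    rw [Nat.add_mod_right, Nat.mod_eq_of_lt hm] at this
    exact Metric.ball_subset_closedBall this
  obtain ⟨x, hx, hxc⟩ := key i hi
  obtain ⟨y, hy, hyc⟩ := key j hj
  rw [Metric.mem_closedBall] at hx hy
  refine ⟨x, ⟨hxc, hεV ?_⟩, y, ⟨hyc, hεV' ?_⟩, ?_⟩
  · have := min_le_left ε ε'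
    exact Metric.mem_ball.2 (by linarith)
  · have := min_le_right ε ε'
    exact Metric.mem_ball.2 (by linarith)
  · rintro rfl
    have := dist_triangle_left (a i) (a j) x
    linarith [hsep i hi j hj hij]

/-- Near a map with a locally constant cycle, every map has a periodic point with a long orbit
near a given point of the cycle. -/
theorem IsLocallyConstantCycle.eventually_perGE {g : C(X, X)} {N : ℕ} {a : ℕ → X}
    (h : IsLocallyConstantCycle g N a) (hX : WLPPP X) {V : Set X} (hV : IsOpen V) {l : ℕ}
    (hl : l ≤ N) (hN : 0 < N) (haV : a 0 ∈ V) :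
    ∀ᶠ f : C(X, X) in 𝓝 g, (perGE f l ∩ V).Nonempty := by
  obtain ⟨𝓑, h𝓑, hper⟩ := hX
  obtain ⟨ε, hε, hεV⟩ := Metric.isOpen_iff.1 hV _ haV
  obtain ⟨r, hr, hrε, hsep, hev⟩ := h.exists_pos hε
  obtain ⟨B, hB, haB, hBr⟩ := h𝓑.mem_nhds_iff.1 (Metric.ball_mem_nhds (a 0) hr)
  obtain ⟨ρ, hρ, hρB⟩ := Metric.isOpen_iff.1 (h𝓑.isOpen hB) _ haB
  have hBr' : closure B ⊆ Metric.closedBall (a 0) r :=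
    closure_minimal (hBr.trans Metric.ball_subset_closedBall) Metric.isClosed_closedBall
  filter_upwards [hev (min r ρ) (by positivity) (min_le_left _ _)] with f hf
  -- The `N`-th iterate sends `closure B` into the `ρ`-ball about `a 0`, hence into `B`. A periodic
  -- point of `F` is one of `f`.
  let F : C(X, X) := ⟨f^[N], f.continuous.iterate N⟩
  obtain ⟨x, hxB, hx⟩ := hper B hB F (by
    rintro _ ⟨y, hy, rfl⟩
    have := hf 0 hN y (hBr' hy) N hN
    rw [Nat.zero_add, Nat.mod_self] at this
    exact hρB (Metric.ball_subset_ball (min_le_right _ _) this))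
  have hxr : x ∈ Metric.ball (a 0) r := hBr hxB
  refine ⟨x, ⟨?_, ?_⟩, hεV (Metric.ball_subset_ball hrε hxr)⟩
  · obtain ⟨m, hm, hmx⟩ := hx
    refine ⟨N * m, Nat.mul_pos hN hm, ?_⟩
    have : (f^[N])^[m] x = x := hmx
    rwa [← Function.iterate_mul] at this
  -- The first `N` iterates lie in pairwise disjoint balls, so they are distinct.
  · have hball : ∀ i < N, f^[i] x ∈ Metric.ball (a i) r := by
      intro i hi
      rcases Nat.eq_zero_or_pos i with rfl | hpos
      · exact hxr
      · have := hf 0 hN x (Metric.ball_subset_closedBall hxr) i hpos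
        rw [Nat.zero_add, Nat.mod_eq_of_lt hi] at this
        exact Metric.ball_subset_ball (min_le_left _ _) this
    have hinj : InjOn (fun i => f^[i] x) (Iio N) := by
      intro i hi j hj hij
      by_contra hne
      have h1 := hball i hi
      have h2 := hball j hj
      simp only at hij
      rw [Metric.mem_ball] at h1 h2
      rw [hij] at h1
      have := dist_triangle_left (a i) (a j) (f^[j] x)
      linarith [hsep i hi j hj hne]
    calc (l : ℕ∞) ≤ (N : ℕ∞) := by exact_mod_cast hl
      _ = (Iio N).encard := by
        rw [← Finset.coe_range, encard_coe_eq_coe_finsetCard, Finset.card_range]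
      _ = ((fun i => f^[i] x) '' Iio N).encard := hinj.encard_image.symm
      _ ≤ _ := encard_le_encard (image_subset_range _ _)

/-- Having two points of `CR(f)` in every neighbourhood of `x` excludes isolation. This form does
not mention `x` inside the neighbourhood, so it suits the Baire argument. -/
theorem PerturbationProperty.eventually_perfect [PerfectSpace X] (hX : PerturbationProperty X) :
    ∀ᶠ f : C(X, X) in residual C(X, X), Perfect (chainRecurrent f) := by
  have key := eventually_residual_forall_mem_chainRecurrent
    (fun (f : C(X, X)) V => (chainRecurrent f ∩ V).Nontrivial)
    (fun f s t hst h => h.mono (inter_subset_inter_right _ hst)) (by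
      intro f x hx V hV hxV ε hε
      obtain ⟨g, hg, N, a, -, hcyc, h0, n, hn, hn0, hnV⟩ :=
        hX.exists_cycle f hx (hV.mem_nhds hxV) hε 0
      exact ⟨g, hg, hcyc.eventually_nontrivial hV (Nat.zero_lt_of_lt hn) hn hn0.symm h0 hnV⟩)
  filter_upwards [key] with f hf
  refine ⟨isClosed_chainRecurrent f, preperfect_iff_nhds.2 fun x hx U hU => ?_⟩
  obtain ⟨y, hy, hyx⟩ := (hf x hx U hU).exists_ne x
  exact ⟨y, hy.symm, hyx⟩

theorem PerturbationProperty.eventually_closure_perGE [PerfectSpace X]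
    (hX : PerturbationProperty X) (hW : WLPPP X) (l : ℕ) :
    ∀ᶠ f : C(X, X) in residual C(X, X), closure (perGE f l) = chainRecurrent f := by
  have key := eventually_residual_forall_mem_chainRecurrent
    (fun (f : C(X, X)) V => (perGE f l ∩ V).Nonempty)
    (fun f s t hst h => h.mono (inter_subset_inter_right _ hst)) (by
      intro f x hx V hV hxV ε hε
      obtain ⟨g, hg, N, a, hl, hcyc, h0, n, hn, -⟩ :=
        hX.exists_cycle f hx (hV.mem_nhds hxV) hε l
      exact ⟨g, hg, hcyc.eventually_perGE hW hV hl (Nat.zero_lt_of_lt hn) h0⟩)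
  filter_upwards [key] with f hf
  refine subset_antisymm (closure_perGE_subset_chainRecurrent f l) fun x hx =>
    mem_closure_iff_nhds.2 fun V hV => ?_
  rw [inter_comm]
  exact hf x hx V hV

end Cycles

end GenericCR

theorem theorem6p2 (X : Type u) [MetricSpace X] [CompactSpace X] [PerfectSpace X]
    (hX : GenericCR.IsANR X ∨
      ∃ n : ℕ, GenericCR.IsNDimensional X n ∧ GenericCR.IsLC X ((n : ℤ) - 1)) :
    (∀ᶠ f : C(X, X) in residual C(X, X), Perfect (GenericCR.chainRecurrent f)) ∧
    (GenericCR.WLPPP X → ∀ l : ℕ, 2 ≤ l →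
      ∀ᶠ f : C(X, X) in residual C(X, X),
        Perfect (GenericCR.chainRecurrent f) ∧
          closure (GenericCR.perGE f l) = GenericCR.chainRecurrent f) := by
  have hP : GenericCR.PerturbationProperty X := by
    rcases hX with hX | ⟨n, hdim, hLC⟩
    · exact hX.perturbationProperty
    · exact hdim.1.perturbationProperty fun k hk => hLC k (by omega)
  exact ⟨hP.eventually_perfect, fun hW l _ =>
    hP.eventually_perfect.and (hP.eventually_closure_perGE hW l)⟩
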